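/- Let $\mathbb{T}=\mathbb{R}/2\pi\mathbb{Z}$ with normalized Haar measure $dt$. Let $(a_n)_{n\in\mathbb{Z}}$ be an even sequence of positive numbers that is convex, i.e. $a_n+a_{n+2}-2a_{n+1}\ge 0$ for all $n\ge 0$, and that satisfies $a_n\log n=O(1)$ as $n\to\infty$. Put $$f(t)=\sum_{j=0}^{\infty}(j+1)\,(a_j+a_{j+2}-2a_{j+1})\,F_j(t),\qquad F_j(t)=\sum_{|k|\le j}\Bigl(1-\frac{|k|}{j+1}\Bigr)e^{ikt},$$ and let $S_N(f,t)=\sum_{|n|\le N}\hat f(n)e^{int}$ be the $N$th partial sum of the Fourier series of $f$. Suppose that $S_N(f,\cdot)$ does not converge to $f$ in $L^1(\mathbb{T})$, or that $a_n\log n$ does not tend to $0$ as $n\to\infty$ (either one of the two suffices). Then there is a measurable set $E\subset\mathbb{T}$ for which $\lim_{N\to\infty}\int_E|S_N(f,t)|\,dt$ does not exist. -/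

import Mathlib

open Filter Topology MeasureTheory

noncomputable section

/-- The torus `𝕋 = ℝ / 2πℤ`; here `fourier n t = exp (i n t)`. -/
abbrev Torus : Type := AddCircle (2 * Real.pi)

/-- The normalized Haar measure on the torus. -/
abbrev torusMeasure : Measure Torus :=
  haveI : Fact (0 < 2 * Real.pi) := ⟨Real.two_pi_pos⟩
  AddCircle.haarAddCircle

/-- The `j`-th Fejér kernel `F_j(t) = ∑_{|k| ≤ j} (1 - |k| / (j + 1)) exp (i k t)`. -/
def fejerKernel (j : ℕ) (t : Torus) : ℂ :=
  ∑ k ∈ Finset.Icc (-(j : ℤ)) (j : ℤ), ((1 - |(k : ℝ)| / ((j : ℝ) + 1) : ℝ) : ℂ) * fourier k t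

/-- The sum `f(t) = ∑_{j ≥ 0} (j + 1) (a_j + a_{j+2} - 2 a_{j+1}) F_j(t)` (pointwise; its value at
the single point `t = 0`, where the series may diverge, is immaterial). -/
def fejerSum (a : ℤ → ℝ) (t : Torus) : ℂ :=
  ∑' j : ℕ, ((((j : ℝ) + 1) * (a j + a (j + 2) - 2 * a (j + 1)) : ℝ) : ℂ) * fejerKernel j t

/-- The `N`-th symmetric partial sum `S_N(f, t) = ∑_{|n| ≤ N} f̂(n) exp (i n t)` of the Fourier
series of `f`. -/
def fourierPartialSum (f : Torus → ℂ) (N : ℕ) (t : Torus) : ℂ :=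
  haveI : Fact (0 < 2 * Real.pi) := ⟨Real.two_pi_pos⟩
  ∑ n ∈ Finset.Icc (-(N : ℤ)) (N : ℤ), fourierCoeff f n * fourier n t

end

/-! Summing by parts twice gives `S_N(f) = f + a_N D_N + r_N` with `r_N → 0` in `L¹`: `r_N` consists
of a tail of the absolutely convergent Fejér series and `(a_N - a_{N+1}) N F_{N-1}`, of norm `N (a_N
- a_{N+1}) → 0` (`sum_fejerKernel_add_eq`, `tendsto_mul_sub_succ_of_convex`).

Put `h_N = a_N D_N`. Either alternative of the hypothesis forbids `‖h_N‖₁ → 0`: the first because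
`‖S_N(f) - f‖₁ ≤ ‖h_N‖₁ + ‖r_N‖₁`, the second because `log N ≤ π ‖D_N‖₁`. Yet `h_N → 0` uniformly
away from `0`, so its mass concentrates there, and a gliding hump argument
(`exists_measurableSet_not_tendsto_setIntegral`) gives a union `E` of rings around `0` on which `∫_E
|h_N|` oscillates. Finally `∫_E |S_N(f)| - ∫_E |h_N| → ∫_E |f|`
(`tendsto_setIntegral_norm_sub_norm`), so `∫_E |S_N(f)|` oscillates too. -/

instance fact_two_pi_pos : Fact (0 < 2 * Real.pi) := ⟨Real.two_pi_pos⟩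

/-! ### Dirichlet and Fejér kernels. -/

theorem sum_Icc_neg_succ {M : Type*} [AddCommMonoid M] (g : ℤ → M) (n : ℕ) :
    ∑ k ∈ Finset.Icc (-((n + 1 : ℕ) : ℤ)) ((n + 1 : ℕ) : ℤ), g k =
      ∑ k ∈ Finset.Icc (-(n : ℤ)) (n : ℤ), g k + (g (n + 1) + g (-(n + 1))) := by
  have h : Finset.Icc (-((n + 1 : ℕ) : ℤ)) ((n + 1 : ℕ) : ℤ) =
      insert ((n : ℤ) + 1) (insert (-((n : ℤ) + 1)) (Finset.Icc (-(n : ℤ)) (n : ℤ))) := by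
    ext k
    simp only [Finset.mem_Icc, Finset.mem_insert]
    omega
  rw [h, Finset.sum_insert, Finset.sum_insert]
  · rw [← add_assoc, add_comm]
  · simp only [Finset.mem_Icc]; omega
  · simp only [Finset.mem_Icc, Finset.mem_insert]; omega

/-- The Dirichlet kernel. -/
noncomputable def dirichletKernel (n : ℕ) (t : Torus) : ℂ :=
  ∑ k ∈ Finset.Icc (-(n : ℤ)) (n : ℤ), fourier k t

theorem dirichletKernel_zero (t : Torus) : dirichletKernel 0 t = 1 := by
  simp [dirichletKernel]

theorem dirichletKernel_succ (n : ℕ) (t : Torus) :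
    dirichletKernel (n + 1) t =
      dirichletKernel n t + (fourier (n + 1 : ℤ) t + fourier (-(n + 1) : ℤ) t) :=
  sum_Icc_neg_succ (fun k => fourier k t) n

theorem norm_fourier_apply (n : ℤ) (t : Torus) : ‖fourier n t‖ = 1 := by
  rw [fourier_apply, Circle.norm_coe]

theorem dirichletKernel_mul (n : ℕ) (t : Torus) :
    dirichletKernel n t * (fourier 1 t - 1) = fourier (n + 1 : ℤ) t - fourier (-n : ℤ) t := by
  induction n with
  | zero => simp [dirichletKernel_zero]
  | succ n ih =>
    rw [dirichletKernel_succ, add_mul, ih]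
    have h1 : fourier (((n + 1 : ℕ) : ℤ) + 1) t = fourier (n + 1 : ℤ) t * fourier 1 t := by
      rw [← fourier_add]; push_cast; rfl
    have h2 : fourier (-n : ℤ) t = fourier (-(n + 1) : ℤ) t * fourier 1 t := by
      rw [← fourier_add]; congr 2; ring
    rw [h1, h2]
    push_cast
    ring

theorem norm_dirichletKernel_mul_le (n : ℕ) (t : Torus) :
    ‖dirichletKernel n t‖ * ‖fourier 1 t - 1‖ ≤ 2 := by
  rw [← norm_mul, dirichletKernel_mul]
  refine (norm_sub_le _ _).trans ?_
  rw [norm_fourier_apply, norm_fourier_apply]; norm_num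

/-- This gives positivity of the Fejér kernel, so that its `L¹` norm is its mean. -/
theorem sum_dirichletKernel_eq (n : ℕ) (t : Torus) :
    ∑ l ∈ Finset.range n, dirichletKernel l t =
      ((‖∑ k ∈ Finset.range n, fourier (k : ℤ) t‖ ^ 2 : ℝ) : ℂ) := by
  have key : ∀ z : ℂ, ((‖z‖ ^ 2 : ℝ) : ℂ) = z * (starRingEnd ℂ) z := fun z => by
    rw [Complex.mul_conj, Complex.normSq_eq_norm_sq]
  -- With `s = ∑_{k<n} e^{ikt}` this reads `D_n = 1 + 2 Re (s e^{-int}) = |s + e^{int}|² - |s|²`,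
  -- the increment needed in the induction.
  have hD : ∀ n : ℕ, dirichletKernel n t =
      1 + ((∑ k ∈ Finset.range n, fourier (k : ℤ) t) * fourier (-n : ℤ) t +
        (∑ k ∈ Finset.range n, fourier (-k : ℤ) t) * fourier (n : ℤ) t) := by
    intro n
    induction n with
    | zero => simp [dirichletKernel_zero]
    | succ n ih =>
      have e0 : fourier (-((n + 1 : ℕ) : ℤ)) t = fourier (-n : ℤ) t * fourier (-1) t := by
        rw [← fourier_add]; congr 2; push_cast; ring
      have e1 : fourier ((n + 1 : ℕ) : ℤ) t = fourier (n : ℤ) t * fourier 1 t := by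
        rw [← fourier_add]; push_cast; rfl
      have s0 : ∀ n : ℕ, (∑ k ∈ Finset.range n, fourier (k : ℤ) t) * fourier (-n : ℤ) t =
          ∑ k ∈ Finset.range n, fourier (-(k + 1) : ℤ) t := by
        intro n
        rw [Finset.sum_mul, ← Finset.sum_range_reflect]
        refine Finset.sum_congr rfl fun k hk => ?_
        rw [← fourier_add]
        congr 2
        have := Finset.mem_range.1 hk
        omega
      have s1 : ∀ n : ℕ, (∑ k ∈ Finset.range n, fourier (-k : ℤ) t) * fourier (n : ℤ) t =
          ∑ k ∈ Finset.range n, fourier (k + 1 : ℤ) t := by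
        intro n
        rw [Finset.sum_mul, ← Finset.sum_range_reflect]
        refine Finset.sum_congr rfl fun k hk => ?_
        rw [← fourier_add]
        congr 2
        have := Finset.mem_range.1 hk
        omega
      rw [dirichletKernel_succ, ih, s0, s1, s0, s1, Finset.sum_range_succ, Finset.sum_range_succ]
      ring
  induction n with
  | zero => simp
  | succ n ih =>
    rw [Finset.sum_range_succ, ih, key, key, Finset.sum_range_succ, map_add, map_sum, hD]
    simp only [← fourier_neg]
    have : fourier (n : ℤ) t * fourier (-n : ℤ) t = 1 := by
      rw [← fourier_add]; simp
    linear_combination -this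

theorem succ_mul_fejerKernel (j : ℕ) (t : Torus) :
    ((j : ℂ) + 1) * fejerKernel j t = ∑ l ∈ Finset.range (j + 1), dirichletKernel l t := by
  have h : ∀ j : ℕ, ((j : ℂ) + 1) * fejerKernel j t =
      ∑ k ∈ Finset.Icc (-(j : ℤ)) (j : ℤ), (((j : ℝ) + 1 - |(k : ℝ)| : ℝ) : ℂ) * fourier k t := by
    intro j
    rw [fejerKernel, Finset.mul_sum]
    refine Finset.sum_congr rfl fun k _ => ?_
    have : (j : ℂ) + 1 ≠ 0 := Nat.cast_add_one_ne_zero j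
    push_cast
    field_simp
  rw [h]
  induction j with
  | zero => simp [dirichletKernel_zero]
  | succ j ih =>
    -- The weight `j + 1 - |k|` vanishes at `k = ±(j + 1)`, so the range can be enlarged for free.
    have e : ∑ k ∈ Finset.Icc (-((j + 1 : ℕ) : ℤ)) ((j + 1 : ℕ) : ℤ),
        (((j : ℝ) + 1 - |(k : ℝ)| : ℝ) : ℂ) * fourier k t =
        ∑ l ∈ Finset.range (j + 1), dirichletKernel l t := by
      rw [sum_Icc_neg_succ, ih]
      have : |(j : ℝ) + 1| = j + 1 := abs_of_nonneg (by positivity)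
      have h' : |-1 + -(j : ℝ)| = j + 1 := by rw [← this, ← abs_neg]; congr 1; ring
      simp [this, h']
    rw [Finset.sum_range_succ, ← e, dirichletKernel, ← Finset.sum_add_distrib]
    refine Finset.sum_congr rfl fun k _ => ?_
    push_cast
    ring

theorem continuous_dirichletKernel (n : ℕ) : Continuous (dirichletKernel n) := by
  unfold dirichletKernel; fun_prop

theorem continuous_fejerKernel (n : ℕ) : Continuous (fejerKernel n) := by
  unfold fejerKernel; fun_prop

theorem Continuous.integrable_torus {E : Type*} [NormedAddCommGroup E] {g : Torus → E}
    (hg : Continuous g) : Integrable g torusMeasure :=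
  hg.integrable_of_hasCompactSupport (HasCompactSupport.of_compactSpace g)

theorem fourierCoeff_sum_fourier (s : Finset ℤ) (c : ℤ → ℂ) (n : ℤ) :
    fourierCoeff (fun t : Torus => ∑ k ∈ s, c k * fourier k t) n = if n ∈ s then c n else 0 := by
  have h := fourierCoeff.sum (T := 2 * Real.pi) s (fun k t => c k * fourier k t) (fun k _ =>
    Continuous.integrable_torus (by fun_prop))
  have h2 : (fun t : Torus => ∑ k ∈ s, c k * fourier k t) =
      ∑ k ∈ s, fun t : Torus => c k * fourier k t := by
    ext t; simp
  have h3 : ∀ k : ℤ, fourierCoeff (fourier k : Torus → ℂ) n = if n = k then 1 else 0 := by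
    intro k
    rw [fourierCoeff_fourier]
    simp [Pi.single_apply]
  rw [h2, h, Finset.sum_apply]
  simp only [fourierCoeff.const_mul, h3]
  simp

theorem norm_fourierCoeff_le (g : Torus → ℂ) (n : ℤ) :
    ‖fourierCoeff g n‖ ≤ ∫ t, ‖g t‖ ∂torusMeasure := by
  refine (norm_integral_le_integral_norm _).trans (le_of_eq ?_)
  simp only [norm_smul, norm_fourier_apply, one_mul]

theorem integral_norm_sum_dirichletKernel (n : ℕ) :
    ∫ t, ‖∑ l ∈ Finset.range n, dirichletKernel l t‖ ∂torusMeasure = n := by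
  have h1 : ∀ l, ∫ t, dirichletKernel l t ∂torusMeasure = 1 := by
    intro l
    have := fourierCoeff_sum_fourier (Finset.Icc (-(l : ℤ)) l) (fun _ => 1) 0
    simpa [fourierCoeff, dirichletKernel] using this
  have h2 : ((∫ t, ‖∑ l ∈ Finset.range n, dirichletKernel l t‖ ∂torusMeasure : ℝ) : ℂ) = n := by
    rw [← integral_complex_ofReal]
    have : ∀ t, ((‖∑ l ∈ Finset.range n, dirichletKernel l t‖ : ℝ) : ℂ) =
        ∑ l ∈ Finset.range n, dirichletKernel l t := by
      intro t
      rw [sum_dirichletKernel_eq, Complex.norm_of_nonneg (by positivity)]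
    simp_rw [this]
    rw [integral_finsetSum _ fun l _ => (continuous_dirichletKernel l).integrable_torus]
    simp [h1]
  exact_mod_cast h2

theorem integral_norm_fejerKernel (j : ℕ) : ∫ t, ‖fejerKernel j t‖ ∂torusMeasure = 1 := by
  have h := integral_norm_sum_dirichletKernel (j + 1)
  simp_rw [← succ_mul_fejerKernel, norm_mul, integral_const_mul] at h
  have e : ‖(j : ℂ) + 1‖ = j + 1 := by
    rw [← Nat.cast_succ, Complex.norm_natCast]; push_cast; rfl
  rw [e] at h
  push_cast at h
  have : (j : ℝ) + 1 ≠ 0 := by positivity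
  exact mul_left_cancel₀ this (by rw [h, mul_one])

/-! ### The gliding hump. -/

theorem exists_measurableSet_not_tendsto_setIntegral {X : Type*} [MeasurableSpace X]
    {μ : Measure X} {h : ℕ → X → ℝ} (hi : ∀ N, Integrable (h N) μ) (h0 : ∀ N x, 0 ≤ h N x)
    {A : ℕ → Set X} (hA : Antitone A) (hAm : ∀ k, MeasurableSet (A k)) (hA0 : μ (⋂ k, A k) = 0)
    (hout : ∀ k, Tendsto (fun N => ∫ x in (A k)ᶜ, h N x ∂μ) atTop (𝓝 0))
    (hnot : ¬ Tendsto (fun N => ∫ x, h N x ∂μ) atTop (𝓝 0)) :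
    ∃ E, MeasurableSet E ∧ ¬ ∃ L : ℝ, Tendsto (fun N => ∫ x in E, h N x ∂μ) atTop (𝓝 L) := by
  have hin : ∀ N, Tendsto (fun k => ∫ x in A k, h N x ∂μ) atTop (𝓝 0) := by
    intro N
    have := tendsto_setIntegral_of_antitone hAm hA ⟨0, (hi N).integrableOn⟩
    rwa [setIntegral_measure_zero _ hA0] at this
  obtain ⟨ε, hε, hfreq⟩ : ∃ ε > 0, ∀ M, ∃ N ≥ M, ε ≤ ∫ x, h N x ∂μ := by
    rw [Metric.tendsto_atTop] at hnot
    push Not at hnot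
    obtain ⟨ε, hε, H⟩ := hnot
    refine ⟨ε, hε, fun M => ?_⟩
    obtain ⟨N, hN, hle⟩ := H M
    rw [Real.dist_eq, sub_zero, abs_of_nonneg (integral_nonneg (h0 N))] at hle
    exact ⟨N, hN, hle⟩
  -- All but `ε / 4` of the mass of `h N` lies in the ring `A k \ A k'`: `N` is chosen large for
  -- `k`, then `k'` large for `N`.
  have step : ∀ k M, ∃ N k', M ≤ N ∧ k ≤ k' ∧ ε ≤ ∫ x, h N x ∂μ ∧
      ∫ x in (A k)ᶜ, h N x ∂μ < ε / 8 ∧ ∫ x in A k', h N x ∂μ < ε / 8 := by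
    intro k M
    obtain ⟨M', hM'⟩ := eventually_atTop.1 ((hout k).eventually_lt_const (by positivity : 0 < ε / 8))
    obtain ⟨N, hN, hle⟩ := hfreq (max M M')
    obtain ⟨k', hk', hk⟩ := (((hin N).eventually_lt_const (by positivity : 0 < ε / 8)).and
      (eventually_ge_atTop k)).exists
    exact ⟨N, k', (le_max_left _ _).trans hN, hk, hle, hM' _ ((le_max_right _ _).trans hN), hk'⟩
  choose φ ψ hφ hψ hbig hsmall hsmall' using step
  let κ : ℕ → ℕ := fun i => Nat.rec 0 (fun i k => ψ k i) i
  have κ_succ : ∀ i, κ (i + 1) = ψ (κ i) i := fun i => rfl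
  have hκ : Monotone κ := monotone_nat_of_le_succ fun i => hψ _ _
  have hanti : ∀ {i j}, i ≤ j → A (κ j) ⊆ A (κ i) := fun hij => hA (hκ hij)
  let n : ℕ → ℕ := fun i => φ (κ i) i
  have hn : Tendsto n atTop atTop := tendsto_atTop_mono (fun i => hφ _ _) tendsto_id
  let E : Set X := ⋃ i, A (κ (2 * i)) \ A (κ (2 * i + 1))
  have hE : MeasurableSet E := .iUnion fun i => (hAm _).diff (hAm _)
  have tail : ∀ i, ∫ x in (A (κ i))ᶜ ∪ A (κ (i + 1)), h (n i) x ∂μ ≤ ε / 4 := by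
    intro i
    have hd : Disjoint (A (κ i))ᶜ (A (κ (i + 1))) :=
      Set.disjoint_left.2 fun x hx hx' => hx (hanti i.le_succ hx')
    rw [setIntegral_union hd (hAm _) (hi _).integrableOn (hi _).integrableOn]
    have := hsmall (κ i) i
    have := hsmall' (κ i) i
    rw [← κ_succ] at this
    linarith
  refine ⟨E, hE, ?_⟩
  rintro ⟨L, hL⟩
  -- `E` contains every ring of even index and misses every ring of odd index, so the integrals stay
  -- above `3ε / 4` along even indices and below `ε / 4` along odd ones.
  have heven : ∀ i, ε * (3 / 4) ≤ ∫ x in E, h (n (2 * i)) x ∂μ := by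
    intro i
    have hsub : Eᶜ ⊆ (A (κ (2 * i)))ᶜ ∪ A (κ (2 * i + 1)) := by
      intro x hx
      by_contra hx'
      simp only [Set.mem_union, Set.mem_compl_iff, not_or, not_not] at hx'
      exact hx (Set.mem_iUnion.2 ⟨i, hx'⟩)
    have h1 : ∫ x in Eᶜ, h (n (2 * i)) x ∂μ ≤
        ∫ x in (A (κ (2 * i)))ᶜ ∪ A (κ (2 * i + 1)), h (n (2 * i)) x ∂μ :=
      setIntegral_mono_set (hi (n (2 * i))).integrableOn
      (Eventually.of_forall (h0 (n (2 * i)))) (ae_of_all μ hsub)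
    have h2 := integral_add_compl hE (hi (n (2 * i)))
    have := tail (2 * i)
    have := hbig (κ (2 * i)) (2 * i)
    linarith
  have hodd : ∀ i, ∫ x in E, h (n (2 * i + 1)) x ∂μ ≤ ε * (1 / 4) := by
    intro i
    have hsub : E ⊆ (A (κ (2 * i + 1)))ᶜ ∪ A (κ (2 * i + 1 + 1)) := by
      intro x hx
      obtain ⟨m, hm, hm'⟩ := Set.mem_iUnion.1 hx
      rcases le_or_gt m i with hmi | hmi
      · exact Or.inl fun hx' => hm' (hanti (show 2 * m + 1 ≤ 2 * i + 1 by omega) hx')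
      · exact Or.inr (hanti (show 2 * i + 1 + 1 ≤ 2 * m by omega) hm)
    have h1 : ∫ x in E, h (n (2 * i + 1)) x ∂μ ≤
        ∫ x in (A (κ (2 * i + 1)))ᶜ ∪ A (κ (2 * i + 1 + 1)), h (n (2 * i + 1)) x ∂μ :=
      setIntegral_mono_set (hi (n (2 * i + 1))).integrableOn
      (Eventually.of_forall (h0 (n (2 * i + 1)))) (ae_of_all μ hsub)
    have := tail (2 * i + 1)
    linarith
  have t0 : Tendsto (fun i : ℕ => 2 * i) atTop atTop :=
    tendsto_atTop_mono (fun i => by simp only [id]; omega) tendsto_id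
  have t1 : Tendsto (fun i : ℕ => 2 * i + 1) atTop atTop :=
    tendsto_atTop_mono (fun i => by simp only [id]; omega) tendsto_id
  have l0 := ge_of_tendsto' (hL.comp (hn.comp t0)) heven
  have l1 := le_of_tendsto' (hL.comp (hn.comp t1)) hodd
  linarith

/-! ### Series absolutely convergent in `L¹`. -/

theorem integrable_tsum_and_tendsto_integral_norm_sub {X : Type*} [MeasurableSpace X]
    {μ : Measure X} {F : ℕ → X → ℂ} (hF : ∀ j, Integrable (F j) μ)
    (hs : Summable fun j => ∫ x, ‖F j x‖ ∂μ) :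
    Integrable (fun x => ∑' j, F j x) μ ∧
      Tendsto (fun N => ∫ x, ‖(∑' j, F j x) - ∑ j ∈ Finset.range N, F j x‖ ∂μ) atTop (𝓝 0) := by
  have hfin : ∑' j, ∫⁻ x, ‖F j x‖ₑ ∂μ ≠ ⊤ := by
    have : ∀ j, ∫⁻ x, ‖F j x‖ₑ ∂μ = ENNReal.ofReal (∫ x, ‖F j x‖ ∂μ) := fun j =>
      (ofReal_integral_norm_eq_lintegral_enorm (hF j)).symm
    simp_rw [this]
    exact hs.tsum_ofReal_ne_top
  have hmeas : ∀ j, AEMeasurable (fun x => ‖F j x‖ₑ) μ := fun j => (hF j).1.enorm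
  have hae : ∀ᵐ x ∂μ, Summable fun j => F j x := by
    have h1 : ∫⁻ x, ∑' j, ‖F j x‖ₑ ∂μ ≠ ⊤ := by rwa [lintegral_tsum hmeas]
    filter_upwards [ae_lt_top' (AEMeasurable.tsum hmeas) h1] with x hx
    refine Summable.of_norm ?_
    have := ENNReal.summable_toReal hx.ne
    simpa using this
  have hfm : AEStronglyMeasurable (fun x => ∑' j, F j x) μ := by
    refine aestronglyMeasurable_of_tendsto_ae atTop
      (f := fun N x => ∑ j ∈ Finset.range N, F j x) (fun N => ?_) ?_
    · exact (integrable_finsetSum _ fun j _ => hF j).1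
    · filter_upwards [hae] with x hx using hx.hasSum.tendsto_sum_nat
  have hbound : ∀ N, ∫⁻ x, ‖(∑' j, F j x) - ∑ j ∈ Finset.range N, F j x‖ₑ ∂μ ≤
      ∑' j, ∫⁻ x, ‖F (j + N) x‖ₑ ∂μ := by
    intro N
    rw [← lintegral_tsum fun j => hmeas _]
    refine lintegral_mono_ae ?_
    filter_upwards [hae] with x hx
    rw [← hx.sum_add_tsum_nat_add N, add_sub_cancel_left]
    exact enorm_tsum_le_tsum_enorm
  have hlim : Tendsto (fun N => ∫⁻ x, ‖(∑' j, F j x) - ∑ j ∈ Finset.range N, F j x‖ₑ ∂μ)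
      atTop (𝓝 0) :=
    tendsto_of_tendsto_of_tendsto_of_le_of_le tendsto_const_nhds
      (ENNReal.tendsto_sum_nat_add _ hfin) (fun _ => zero_le) hbound
  refine ⟨⟨hfm, ?_⟩, ?_⟩
  · have := hbound 0
    simp only [Finset.range_zero, Finset.sum_empty, sub_zero, add_zero] at this
    exact this.trans_lt hfin.lt_top
  · have := (ENNReal.tendsto_toReal ENNReal.zero_ne_top).comp hlim
    refine this.congr fun N => ?_
    rw [Function.comp_apply, integral_norm_eq_lintegral_enorm]
    exact hfm.sub (integrable_finsetSum _ fun j _ => hF j).1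

/-! ### Logarithmic lower bound for the Lebesgue constants. -/

theorem integral_torus_eq_intervalIntegral {E : Type*} [NormedAddCommGroup E] [NormedSpace ℝ E]
    (g : Torus → E) :
    ∫ t, g t ∂torusMeasure = (2 * Real.pi)⁻¹ • ∫ x in (0 : ℝ)..2 * Real.pi, g x := by
  have := AddCircle.intervalIntegral_preimage (2 * Real.pi) 0 g
  rw [zero_add] at this
  rw [AddCircle.integral_haarAddCircle, ← this]

theorem integral_fourier_mul_sub_pi {n : ℤ} (hn : n ≠ 0) :
    ∫ x in (0 : ℝ)..2 * Real.pi, fourier n (x : Torus) * ((x : ℂ) - Real.pi) =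
      2 * Real.pi / (Complex.I * n) := by
  have hnc : (n : ℂ) ≠ 0 := by exact_mod_cast hn
  have he : ∀ x : ℝ, fourier n (x : Torus) = Complex.exp (Complex.I * n * x) := by
    intro x
    rw [fourier_coe_apply]
    congr 1
    have : (Real.pi : ℂ) ≠ 0 := by exact_mod_cast Real.pi_ne_zero
    push_cast
    field_simp
  have hd : ∀ x : ℝ, HasDerivAt (fun x : ℝ => Complex.exp (Complex.I * n * x))
      (Complex.exp (Complex.I * n * x) * (Complex.I * n)) x := by
    intro x
    have h1 : HasDerivAt (fun x : ℝ => Complex.I * n * (x : ℂ)) (Complex.I * n) x := by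
      simpa using (Complex.ofRealCLM.hasDerivAt (x := x)).const_mul (Complex.I * n)
    exact h1.cexp
  have hF : ∀ x : ℝ, HasDerivAt (fun x : ℝ => Complex.exp (Complex.I * n * x) *
      (((x : ℂ) - Real.pi) / (Complex.I * n) + 1 / n ^ 2))
      (Complex.exp (Complex.I * n * x) * ((x : ℂ) - Real.pi)) x := by
    intro x
    have h2 : HasDerivAt (fun x : ℝ => ((x : ℂ) - Real.pi) / (Complex.I * n) + 1 / (n : ℂ) ^ 2)
        (1 / (Complex.I * n)) x :=
      (((Complex.ofRealCLM.hasDerivAt (x := x)).sub_const _).div_const _).add_const _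
    refine ((hd x).mul h2).congr_deriv ?_
    field_simp
    linear_combination Complex.I_sq
  simp_rw [he]
  rw [intervalIntegral.integral_eq_sub_of_hasDerivAt (fun x _ => hF x)
    (Continuous.intervalIntegrable (by fun_prop) _ _)]
  have e1 : Complex.exp (Complex.I * n * ((2 * Real.pi : ℝ) : ℂ)) = 1 := by
    rw [Complex.exp_eq_one_iff]
    exact ⟨n, by push_cast; ring⟩
  rw [e1]
  simp only [Complex.ofReal_zero, mul_zero, Complex.exp_zero]
  push_cast
  ring

theorem sum_Icc_neg_one_div (N : ℕ) :
    ∑ k ∈ Finset.Icc (-(N : ℤ)) (N : ℤ), 1 / ((N : ℝ) + 1 + k) = (harmonic (2 * N + 1) : ℝ) := by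
  rw [harmonic]
  push_cast
  refine Finset.sum_nbij' (fun k => (k + N).toNat) (fun m => (m : ℤ) - N) ?_ ?_ ?_ ?_ ?_
  · intro k hk
    simp only [Finset.mem_Icc, Finset.mem_range] at hk ⊢; omega
  · intro k hk
    simp only [Finset.mem_Icc, Finset.mem_range] at hk ⊢; omega
  · intro k hk
    simp only [Finset.mem_Icc] at hk ⊢; omega
  · intro k hk
    omega
  · intro k hk
    simp only [Finset.mem_Icc] at hk
    have : (((k + N).toNat : ℤ) : ℝ) = ((k + N : ℤ) : ℝ) := by
      rw [Int.toNat_of_nonneg (by omega)]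
    rw [Int.cast_natCast] at this
    rw [this, one_div]
    push_cast
    congr 1
    ring

/-- Duality: `D_N` is tested against `e^{i(N+1)x} (x - π)`, of modulus at most `π`. The shift moves
the frequencies to `1, …, 2N + 1`, so the sawtooth coefficients `2π / (i n)` add up without
cancellation to a harmonic number. -/
theorem log_le_pi_mul_integral_norm_dirichletKernel (N : ℕ) :
    Real.log N ≤ Real.pi * ∫ t, ‖dirichletKernel N t‖ ∂torusMeasure := by
  have hpi := Real.pi_pos
  set J : ℂ := ∫ x in (0 : ℝ)..2 * Real.pi,
    (fourier (N + 1 : ℤ) (x : Torus) * dirichletKernel N x) * ((x : ℂ) - Real.pi) with hJ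
  have c1 : ∀ n : ℤ, Continuous fun x : ℝ => fourier n (x : Torus) := fun n =>
    (map_continuous (fourier n)).comp (AddCircle.continuous_mk' _)
  have c2 : Continuous fun x : ℝ => dirichletKernel N (x : Torus) :=
    (continuous_dirichletKernel N).comp (AddCircle.continuous_mk' _)
  have hval : J = 2 * Real.pi / Complex.I * ((harmonic (2 * N + 1) : ℝ) : ℂ) := by
    have : ∀ x : ℝ, (fourier (N + 1 : ℤ) (x : Torus) * dirichletKernel N x) *
        ((x : ℂ) - Real.pi) = ∑ k ∈ Finset.Icc (-(N : ℤ)) (N : ℤ),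
          fourier (N + 1 + k : ℤ) (x : Torus) * ((x : ℂ) - Real.pi) := by
      intro x
      rw [dirichletKernel, Finset.mul_sum, Finset.sum_mul]
      refine Finset.sum_congr rfl fun k _ => ?_
      rw [fourier_add (m := (N + 1 : ℤ))]
    simp_rw [hJ, this]
    have hcont : ∀ n : ℤ, Continuous fun x : ℝ => fourier n (x : Torus) * ((x : ℂ) - Real.pi) :=
      fun n => (c1 n).mul (by fun_prop)
    rw [intervalIntegral.integral_finsetSum fun k _ => (hcont _).intervalIntegrable _ _, ← sum_Icc_neg_one_div]
    push_cast
    rw [Finset.mul_sum]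
    refine Finset.sum_congr rfl fun k hk => ?_
    rw [integral_fourier_mul_sub_pi (by have := Finset.mem_Icc.1 hk; omega)]
    push_cast
    rw [div_mul_div_comm, mul_one]
  have hnorm : ‖J‖ = 2 * Real.pi * (harmonic (2 * N + 1) : ℝ) := by
    have h0 : (0 : ℝ) ≤ (harmonic (2 * N + 1) : ℝ) := by
      exact_mod_cast (harmonic_pos (by omega)).le
    rw [hval, norm_mul, norm_div, norm_mul, Complex.norm_I, Complex.norm_real, Complex.norm_real,
      Real.norm_of_nonneg h0, Real.norm_of_nonneg hpi.le]
    simp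
  have hle : ‖J‖ ≤ ∫ x in (0 : ℝ)..2 * Real.pi, Real.pi * ‖dirichletKernel N (x : Torus)‖ := by
    refine intervalIntegral.norm_integral_le_of_norm_le (by positivity)
      (ae_of_all _ fun x hx => ?_) ((continuous_const.mul c2.norm).intervalIntegrable _ _)
    rw [norm_mul, norm_mul, norm_fourier_apply, one_mul, mul_comm]
    refine mul_le_mul_of_nonneg_right ?_ (norm_nonneg _)
    rw [← Complex.ofReal_sub, Complex.norm_real, Real.norm_eq_abs, abs_le]
    constructor <;> linarith [hx.1, hx.2]
  have hlog : Real.log N ≤ (harmonic (2 * N + 1) : ℝ) := by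
    refine le_trans ?_ (log_add_one_le_harmonic _)
    rcases Nat.eq_zero_or_pos N with rfl | hN
    · simp [Real.log_nonneg]
    · refine Real.log_le_log (by exact_mod_cast hN) ?_
      push_cast; linarith [(Nat.cast_nonneg N : (0 : ℝ) ≤ N)]
  rw [integral_torus_eq_intervalIntegral, smul_eq_mul]
  rw [intervalIntegral.integral_const_mul, hnorm] at hle
  refine hlog.trans ?_
  rw [← mul_le_mul_iff_right₀ (by positivity : 0 < 2 * Real.pi)]
  refine hle.trans (le_of_eq ?_)
  field_simp

/-! ### Convex null sequences. -/

section ConvexSequence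

variable {b : ℕ → ℝ}

theorem antitone_sub_succ_of_convex (hc : ∀ n, 0 ≤ b n + b (n + 2) - 2 * b (n + 1)) :
    Antitone fun n => b n - b (n + 1) :=
  antitone_nat_of_succ_le fun n => by
    have := hc n
    rw [show n + 2 = n + 1 + 1 from rfl] at this
    linarith

theorem tendsto_sub_succ (h0 : Tendsto b atTop (𝓝 0)) :
    Tendsto (fun n => b n - b (n + 1)) atTop (𝓝 0) := by
  simpa using h0.sub (h0.comp (tendsto_add_atTop_nat 1))

theorem sub_succ_nonneg_of_convex (hc : ∀ n, 0 ≤ b n + b (n + 2) - 2 * b (n + 1))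
    (h0 : Tendsto b atTop (𝓝 0)) (n : ℕ) : 0 ≤ b n - b (n + 1) :=
  (antitone_sub_succ_of_convex hc).le_of_tendsto (tendsto_sub_succ h0) n

/-- The differences decrease, so the last one, times the number of terms between `n / 2` and `n`, is
at most `b (n / 2) - b n`, which tends to `0`. -/
theorem tendsto_mul_sub_succ_of_convex (hc : ∀ n, 0 ≤ b n + b (n + 2) - 2 * b (n + 1))
    (h0 : Tendsto b atTop (𝓝 0)) :
    Tendsto (fun n : ℕ => n * (b n - b (n + 1))) atTop (𝓝 0) := by
  have hanti := antitone_sub_succ_of_convex hc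
  have hnn := sub_succ_nonneg_of_convex hc h0
  have tele : ∀ m k, k * (b (m + k) - b (m + k + 1)) ≤ b m - b (m + k) := by
    intro m k
    have h1 : ∑ i ∈ Finset.range k, (b (m + k) - b (m + k + 1)) ≤
        ∑ i ∈ Finset.range k, (b (m + i) - b (m + (i + 1))) :=
      Finset.sum_le_sum fun i hi =>
        hanti (by have := Finset.mem_range.1 hi; omega : m + i ≤ m + k)
    rw [Finset.sum_range_sub' fun i => b (m + i)] at h1
    simpa only [Finset.sum_const, Finset.card_range, nsmul_eq_mul, add_zero] using h1
  have hdiv : Tendsto (fun n : ℕ => n / 2) atTop atTop :=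
    Nat.tendsto_div_const_atTop (by norm_num)
  have hup : Tendsto (fun n : ℕ => 2 * (b (n / 2) - b n)) atTop (𝓝 0) := by
    simpa using ((h0.comp hdiv).sub h0).const_mul 2
  refine squeeze_zero (fun n => mul_nonneg n.cast_nonneg (hnn n)) (fun n => ?_) hup
  have h1 := tele (n / 2) (n - n / 2)
  rw [show n / 2 + (n - n / 2) = n by omega] at h1
  have h2 : (n : ℝ) ≤ 2 * ((n - n / 2 : ℕ) : ℝ) := by
    exact_mod_cast (by omega : n ≤ 2 * (n - n / 2))
  nlinarith [hnn n]

theorem summable_succ_mul_of_convex (hc : ∀ n, 0 ≤ b n + b (n + 2) - 2 * b (n + 1))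
    (h0 : Tendsto b atTop (𝓝 0)) (hb : ∀ n, 0 ≤ b n) :
    Summable fun j : ℕ => ((j : ℝ) + 1) * (b j + b (j + 2) - 2 * b (j + 1)) := by
  refine summable_of_sum_range_le (c := b 0) (fun j => mul_nonneg (by positivity) (hc j))
    fun N => ?_
  have : ∑ j ∈ Finset.range N, ((j : ℝ) + 1) * (b j + b (j + 2) - 2 * b (j + 1)) =
      b 0 - b N - N * (b N - b (N + 1)) := by
    induction N with
    | zero => simp
    | succ N ih =>
      rw [Finset.sum_range_succ, ih]
      push_cast
      ring
  rw [this]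
  have := mul_nonneg N.cast_nonneg (sub_succ_nonneg_of_convex hc h0 N)
  linarith [hb N]

end ConvexSequence

/-! ### Summation by parts, localization at `0`, Fourier coefficients. -/

theorem sum_fejerKernel_add_eq {a : ℤ → ℝ} (ha : ∀ n, a (-n) = a n) (N : ℕ) (t : Torus) :
    ∑ j ∈ Finset.range N,
        ((((j : ℝ) + 1) * (a j + a (j + 2) - 2 * a (j + 1)) : ℝ) : ℂ) * fejerKernel j t +
      ((a N - a (N + 1) : ℝ) : ℂ) * ∑ l ∈ Finset.range N, dirichletKernel l t +
      (a N : ℂ) * dirichletKernel N t =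
    ∑ k ∈ Finset.Icc (-(N : ℤ)) (N : ℤ), (a k : ℂ) * fourier k t := by
  induction N with
  | zero => simp [dirichletKernel_zero]
  | succ N ih =>
    rw [sum_Icc_neg_succ, ← ih, Finset.sum_range_succ, ha, dirichletKernel_succ]
    have h := succ_mul_fejerKernel N t
    have h2 := Finset.sum_range_succ (fun l => dirichletKernel l t) N
    rw [h2] at h ⊢
    have e : ((N + 1 : ℕ) : ℤ) + 1 = N + 2 := by push_cast; ring
    rw [e]
    push_cast
    linear_combination ((a N : ℂ) + a (N + 2) - 2 * a (N + 1)) * h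

/-- The set of points of the torus close to `0`, as measured by `|exp (i t) - 1|`. -/
def torusNear (k : ℕ) : Set Torus := {t | ‖fourier 1 t - 1‖ < 1 / ((k : ℝ) + 1)}

theorem measurableSet_torusNear (k : ℕ) : MeasurableSet (torusNear k) :=
  (isOpen_lt (by fun_prop) continuous_const).measurableSet

theorem antitone_torusNear : Antitone torusNear := fun i j hij _ ht =>
  lt_of_lt_of_le ht (one_div_le_one_div_of_le (by positivity : (0 : ℝ) < i + 1) (by gcongr))

theorem iInter_torusNear : ⋂ k, torusNear k = {0} := by
  ext t
  simp only [Set.mem_iInter, Set.mem_singleton_iff]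
  constructor
  · intro h
    have h0 : ‖fourier 1 t - 1‖ ≤ 0 :=
      ge_of_tendsto' tendsto_one_div_add_atTop_nhds_zero_nat fun k => (h k).le
    have h1 : fourier 1 t = (1 : ℂ) := sub_eq_zero.1 (norm_le_zero_iff.1 h0)
    rw [fourier_one] at h1
    refine AddCircle.injective_toCircle Real.two_pi_pos.ne' (Circle.ext ?_)
    rw [h1, AddCircle.toCircle_zero, Circle.coe_one]
  · rintro rfl k
    simp only [torusNear, Set.mem_ofPred_eq, fourier_eval_zero, sub_self, norm_zero]
    positivity

theorem norm_dirichletKernel_le_of_notMem {k : ℕ} {t : Torus} (ht : t ∉ torusNear k) (N : ℕ) :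
    ‖dirichletKernel N t‖ ≤ 2 * (k + 1) := by
  have h1 : 1 / ((k : ℝ) + 1) ≤ ‖fourier 1 t - 1‖ := not_lt.1 ht
  have h2 := norm_dirichletKernel_mul_le N t
  have h3 := (mul_le_mul_of_nonneg_left h1 (norm_nonneg (dirichletKernel N t))).trans h2
  rw [mul_one_div, div_le_iff₀ (by positivity)] at h3
  exact h3

/-- For `N ≥ |n|` the `n`th coefficient of the remainder is `a n - f̂(n) - a N`, and it is bounded
by an `L¹` norm tending to `0`. -/
theorem fourierCoeff_eq_of_tendsto {f : Torus → ℂ} (hf : Integrable f torusMeasure)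
    {a : ℤ → ℝ} (h0 : Tendsto (fun n : ℕ => a n) atTop (𝓝 0))
    (hlim : Tendsto (fun N : ℕ => ∫ t, ‖∑ k ∈ Finset.Icc (-(N : ℤ)) (N : ℤ), (a k : ℂ) *
      fourier k t - f t - a N * dirichletKernel N t‖ ∂torusMeasure) atTop (𝓝 0)) (n : ℤ) :
    fourierCoeff f n = a n := by
  have hev : ∀ᶠ N : ℕ in atTop, ‖(a n : ℂ) - fourierCoeff f n - a N‖ ≤
      ∫ t, ‖∑ k ∈ Finset.Icc (-(N : ℤ)) (N : ℤ), (a k : ℂ) *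
        fourier k t - f t - a N * dirichletKernel N t‖ ∂torusMeasure := by
    filter_upwards [eventually_ge_atTop n.natAbs] with N hN
    have hmem : n ∈ Finset.Icc (-(N : ℤ)) (N : ℤ) := by rw [Finset.mem_Icc]; omega
    have e1 := fourierCoeff_sum_fourier (Finset.Icc (-(N : ℤ)) N) (fun k => (a k : ℂ)) n
    have e2 := fourierCoeff_sum_fourier (Finset.Icc (-(N : ℤ)) N) (fun k => (a N : ℂ)) n
    rw [if_pos hmem] at e1 e2
    refine le_trans (le_of_eq ?_) (norm_fourierCoeff_le _ n)
    congr 1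
    have i1 : Integrable (fun t : Torus => ∑ k ∈ Finset.Icc (-(N : ℤ)) (N : ℤ), (a k : ℂ) *
      fourier k t) torusMeasure := Continuous.integrable_torus (by fun_prop)
    have i2 : Integrable (fun t : Torus => ∑ k ∈ Finset.Icc (-(N : ℤ)) (N : ℤ), (a N : ℂ) *
      fourier k t) torusMeasure := Continuous.integrable_torus (by fun_prop)
    have hsub : ∀ {g h : Torus → ℂ}, Integrable g torusMeasure → Integrable h torusMeasure →
        fourierCoeff (fun t => g t - h t) n = fourierCoeff g n - fourierCoeff h n := by
      intro g h hg hh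
      simp only [fourierCoeff, smul_sub]
      exact integral_sub (hg.fourier_smul _) (hh.fourier_smul _)
    simp only [dirichletKernel, Finset.mul_sum]
    have i3 : Integrable (fun t : Torus => ∑ k ∈ Finset.Icc (-(N : ℤ)) (N : ℤ), (a k : ℂ) *
      fourier k t - f t) torusMeasure := i1.sub hf
    rw [hsub i3 i2, hsub i1 hf, e1, e2]
  have h1 : Tendsto (fun N : ℕ => (a n : ℂ) - fourierCoeff f n - a N) atTop (𝓝 0) :=
    squeeze_zero_norm' hev hlim
  have h2 : Tendsto (fun N : ℕ => (a n : ℂ) - fourierCoeff f n - a N) atTop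
      (𝓝 ((a n : ℂ) - fourierCoeff f n - (0 : ℝ))) :=
    tendsto_const_nhds.sub ((Complex.continuous_ofReal.tendsto 0).comp h0)
  have h3 := tendsto_nhds_unique h2 h1
  rw [Complex.ofReal_zero, sub_zero, sub_eq_zero] at h3
  exact h3.symm

/-- `|f + h_N| - |h_N|` is dominated by `|f|` and tends to `|f|` almost everywhere; replacing `f +
h_N` by `S_N` costs only the `L¹` error. -/
theorem tendsto_setIntegral_norm_sub_norm {X : Type*} [MeasurableSpace X] {μ : Measure X}
    {S h : ℕ → X → ℂ} {f : X → ℂ} (hS : ∀ N, Integrable (S N) μ) (hh : ∀ N, Integrable (h N) μ)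
    (hf : Integrable f μ) (hae : ∀ᵐ x ∂μ, Tendsto (fun N => h N x) atTop (𝓝 0))
    (hlim : Tendsto (fun N => ∫ x, ‖S N x - f x - h N x‖ ∂μ) atTop (𝓝 0)) (E : Set X) :
    Tendsto (fun N => ∫ x in E, ‖S N x‖ ∂μ - ∫ x in E, ‖h N x‖ ∂μ) atTop
      (𝓝 (∫ x in E, ‖f x‖ ∂μ)) := by
  have h1 : Tendsto (fun N => ∫ x in E, (‖f x + h N x‖ - ‖h N x‖) ∂μ) atTop
      (𝓝 (∫ x in E, ‖f x‖ ∂μ)) := by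
    refine tendsto_integral_of_dominated_convergence (fun x => ‖f x‖)
      (fun N => ((hf.add (hh N)).norm.sub (hh N).norm).1.restrict) hf.norm.integrableOn
      (fun N => ae_of_all _ fun x => ?_) ?_
    · simpa using abs_norm_sub_norm_le (f x + h N x) (h N x)
    · filter_upwards [ae_restrict_of_ae hae] with x hx
      simpa using (tendsto_const_nhds.add hx).norm.sub hx.norm
  have hi : ∀ N, Integrable (fun x => ‖S N x - f x - h N x‖) μ := fun N =>
    (((hS N).sub hf).sub (hh N)).norm
  have hi1 : ∀ N, Integrable (fun x => ‖S N x‖ - ‖f x + h N x‖) μ := fun N =>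
    (hS N).norm.sub (hf.add (hh N)).norm
  have hi2 : ∀ N, Integrable (fun x => ‖f x + h N x‖ - ‖h N x‖) μ := fun N =>
    (hf.add (hh N)).norm.sub (hh N).norm
  have h2 : Tendsto (fun N => ∫ x in E, (‖S N x‖ - ‖f x + h N x‖) ∂μ) atTop (𝓝 0) := by
    refine squeeze_zero_norm (fun N => ?_) hlim
    refine (norm_integral_le_integral_norm _).trans (le_trans ?_
      (setIntegral_le_integral (s := E) (hi N) (ae_of_all _ fun x => norm_nonneg _)))
    refine integral_mono (hi1 N).norm.integrableOn (hi N).integrableOn fun x => ?_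
    refine (abs_norm_sub_norm_le _ _).trans (le_of_eq ?_)
    congr 1
    ring
  have h3 := h2.add h1
  rw [zero_add] at h3
  refine h3.congr fun N => ?_
  rw [← integral_add (hi1 N).integrableOn (hi2 N).integrableOn,
    ← integral_sub (hS N).norm.integrableOn (hh N).norm.integrableOn]
  simp only [sub_add_sub_cancel]

theorem torusMeasure_singleton_zero : torusMeasure {0} = 0 := by
  have h := AddCircle.volume_closedBall (T := 2 * Real.pi) (x := 0) 0
  rw [Metric.closedBall_zero, mul_zero, min_eq_right Real.two_pi_pos.le, ENNReal.ofReal_zero,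
    AddCircle.volume_eq_smul_haarAddCircle, Measure.smul_apply, smul_eq_mul, mul_eq_zero] at h
  exact h.resolve_left (ENNReal.ofReal_pos.2 Real.two_pi_pos).ne'

/-! ### Proof of the theorem. -/

theorem theorem3 (a : ℤ → ℝ)
    (ha_pos : ∀ n : ℤ, 0 < a n)
    (ha_even : ∀ n : ℤ, a (-n) = a n)
    (ha_convex : ∀ n : ℕ, 0 ≤ a n + a (n + 2) - 2 * a (n + 1))
    (ha_log : (fun n : ℕ => a n * Real.log n) =O[atTop] (fun _ : ℕ => (1 : ℝ)))
    (h_div :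
      ¬ Tendsto (fun N : ℕ =>
          eLpNorm (fun t => fejerSum a t - fourierPartialSum (fejerSum a) N t) 1 torusMeasure)
          atTop (𝓝 0) ∨
      ¬ Tendsto (fun n : ℕ => a n * Real.log n) atTop (𝓝 0)) :
    ∃ E : Set Torus, MeasurableSet E ∧
      ¬ ∃ L : ℝ, Tendsto (fun N : ℕ =>
          ∫ t in E, ‖fourierPartialSum (fejerSum a) N t‖ ∂torusMeasure) atTop (𝓝 L) := by

  set b : ℕ → ℝ := fun n => a n with hb
  have hc : ∀ n, 0 ≤ b n + b (n + 2) - 2 * b (n + 1) := fun n => by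
    simpa [hb] using ha_convex n
  -- `a_n log n` is bounded while `log n → ∞`.
  have h0 : Tendsto b atTop (𝓝 0) := by
    have hlog : Tendsto (fun n : ℕ => Real.log n) atTop atTop :=
      Real.tendsto_log_atTop.comp tendsto_natCast_atTop_atTop
    have h1 := ha_log.mul_isLittleO (Asymptotics.isLittleO_const_left.2 (Or.inr
      (tendsto_norm_atTop_atTop.comp hlog)) :
        (fun _ : ℕ => (1 : ℝ)) =o[atTop] fun n : ℕ => Real.log n)
    have h2 : b =o[atTop] fun _ : ℕ => (1 : ℝ) := by
      rw [Asymptotics.isLittleO_iff] at h1 ⊢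
      intro c hcpos
      filter_upwards [h1 hcpos, hlog.eventually_gt_atTop 0] with n hn hpos
      simp only [mul_one, one_mul, norm_mul, norm_one] at hn ⊢
      exact le_of_mul_le_mul_right hn (norm_pos_iff.2 hpos.ne')
    exact (Asymptotics.isLittleO_one_iff ℝ).1 h2
  have hbpos : ∀ n, 0 ≤ b n := fun n => (ha_pos n).le
  set F : ℕ → Torus → ℂ := fun j t =>
    ((((j : ℝ) + 1) * (a j + a (j + 2) - 2 * a (j + 1)) : ℝ) : ℂ) * fejerKernel j t with hF
  have hFi : ∀ j, Integrable (F j) torusMeasure := fun j =>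
    (continuous_const.mul (continuous_fejerKernel j)).integrable_torus
  have hFs : Summable fun j => ∫ t, ‖F j t‖ ∂torusMeasure := by
    refine (summable_succ_mul_of_convex hc h0 hbpos).congr fun j => ?_
    simp only [hF, norm_mul, integral_const_mul, integral_norm_fejerKernel, mul_one]
    rw [Complex.norm_real, Real.norm_of_nonneg (mul_nonneg (by positivity) (ha_convex j))]
    simp [hb]
  obtain ⟨hfi, hlim⟩ := integrable_tsum_and_tendsto_integral_norm_sub hFi hFs
  change Integrable (fejerSum a) torusMeasure at hfi
  set f := fejerSum a with hf
  set h : ℕ → Torus → ℂ := fun N t => a N * dirichletKernel N t with hh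
  have hhi : ∀ N, Integrable (h N) torusMeasure := fun N =>
    (continuous_const.mul (continuous_dirichletKernel N)).integrable_torus
  have hrem : Tendsto (fun N : ℕ => ∫ t, ‖∑ k ∈ Finset.Icc (-(N : ℤ)) (N : ℤ), (a k : ℂ) *
      fourier k t - f t - a N * dirichletKernel N t‖ ∂torusMeasure) atTop (𝓝 0) := by
    have hup := hlim.add (tendsto_mul_sub_succ_of_convex hc h0)
    rw [add_zero] at hup
    refine squeeze_zero (fun N => integral_nonneg fun _ => norm_nonneg _) (fun N => ?_) hup
    have hK : Continuous fun t : Torus => ∑ l ∈ Finset.range N, dirichletKernel l t :=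
      continuous_finsetSum _ fun l _ => continuous_dirichletKernel l
    have hΔ := sub_succ_nonneg_of_convex hc h0 N
    have i1 : Integrable (fun t => ‖f t - ∑ j ∈ Finset.range N, F j t‖) torusMeasure :=
      (hfi.sub (integrable_finsetSum _ fun j _ => hFi j)).norm
    have i2 : Integrable (fun t => (b N - b (N + 1)) *
        ‖∑ l ∈ Finset.range N, dirichletKernel l t‖) torusMeasure :=
      (continuous_const.mul hK.norm).integrable_torus
    have e : (N : ℝ) * (b N - b (N + 1)) = ∫ t, (b N - b (N + 1)) *
        ‖∑ l ∈ Finset.range N, dirichletKernel l t‖ ∂torusMeasure := by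
      rw [integral_const_mul, integral_norm_sum_dirichletKernel, mul_comm]
    change _ ≤ (∫ t, ‖f t - ∑ j ∈ Finset.range N, F j t‖ ∂torusMeasure) + _
    rw [e, ← integral_add i1 i2]
    refine integral_mono_of_nonneg (ae_of_all _ fun _ => norm_nonneg _) (i1.add i2)
      (ae_of_all _ fun t => ?_)
    have hid := sum_fejerKernel_add_eq ha_even N t
    have e2 : ∑ k ∈ Finset.Icc (-(N : ℤ)) (N : ℤ), (a k : ℂ) * fourier k t - f t -
        a N * dirichletKernel N t = -(f t - ∑ j ∈ Finset.range N, F j t) +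
        ((b N - b (N + 1) : ℝ) : ℂ) * ∑ l ∈ Finset.range N, dirichletKernel l t := by
      rw [← hid]
      simp only [hF, hb]
      push_cast
      ring
    simp only [e2]
    refine (norm_add_le _ _).trans (le_of_eq ?_)
    rw [norm_neg, norm_mul, Complex.norm_real, Real.norm_of_nonneg hΔ]
  have hcoeff : ∀ n, fourierCoeff f n = a n := fourierCoeff_eq_of_tendsto hfi h0 hrem
  have hS : ∀ (N : ℕ) (t : Torus), fourierPartialSum f N t =
      ∑ k ∈ Finset.Icc (-(N : ℤ)) (N : ℤ), (a k : ℂ) * fourier k t := fun N t => by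
    simp only [fourierPartialSum, hcoeff]
  have hSi : ∀ N, Integrable (fourierPartialSum f N) torusMeasure := fun N =>
    Continuous.integrable_torus (by unfold fourierPartialSum; fun_prop)
  simp_rw [← hS] at hrem
  -- Both alternatives of `h_div` are used only here.
  have hnot : ¬ Tendsto (fun N => ∫ t, ‖h N t‖ ∂torusMeasure) atTop (𝓝 0) := by
    intro ht
    rcases h_div with h1 | h1
    · apply h1
      have hup := (ENNReal.tendsto_ofReal (hrem.add ht))
      rw [add_zero, ENNReal.ofReal_zero] at hup
      refine tendsto_of_tendsto_of_tendsto_of_le_of_le tendsto_const_nhds hup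
        (fun _ => zero_le) fun N => ?_
      have i1 : Integrable (fun t => f t - fourierPartialSum f N t) torusMeasure :=
        hfi.sub (hSi N)
      have i2 : Integrable (fun t => ‖fourierPartialSum f N t - f t -
          a N * dirichletKernel N t‖) torusMeasure := (((hSi N).sub hfi).sub (hhi N)).norm
      rw [eLpNorm_one_eq_lintegral_enorm, ← ofReal_integral_norm_eq_lintegral_enorm i1]
      refine ENNReal.ofReal_le_ofReal ?_
      rw [← integral_add i2 (hhi N).norm]
      refine integral_mono i1.norm (i2.add (hhi N).norm) fun t => ?_
      beta_reduce
      rw [norm_sub_rev]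
      refine le_trans (le_of_eq ?_) (norm_add_le _ _)
      congr 1
      ring
    · apply h1
      have hup := ht.const_mul Real.pi
      rw [mul_zero] at hup
      refine squeeze_zero (fun N => mul_nonneg (hbpos N) (Real.log_natCast_nonneg N))
        (fun N => ?_) hup
      simp only [hh, norm_mul, integral_const_mul, Complex.norm_real]
      have := mul_le_mul_of_nonneg_left (log_le_pi_mul_integral_norm_dirichletKernel N) (hbpos N)
      rw [Real.norm_of_nonneg (ha_pos N).le]
      refine this.trans (le_of_eq ?_)
      simp only [hb]
      ring
  have hbound : ∀ (k N : ℕ) (t : Torus), t ∉ torusNear k → ‖h N t‖ ≤ b N * (2 * (k + 1)) := by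
    intro k N t ht
    simp only [hh, norm_mul, Complex.norm_real, Real.norm_of_nonneg (ha_pos N).le]
    exact mul_le_mul_of_nonneg_left (norm_dirichletKernel_le_of_notMem ht N) (hbpos N)
  have hbk : ∀ k : ℕ, Tendsto (fun N => b N * (2 * ((k : ℝ) + 1))) atTop (𝓝 0) := fun k => by
    simpa using h0.mul_const (2 * ((k : ℝ) + 1))
  have hout : ∀ k, Tendsto (fun N => ∫ t in (torusNear k)ᶜ, ‖h N t‖ ∂torusMeasure)
      atTop (𝓝 0) := by
    intro k
    refine squeeze_zero (fun N => integral_nonneg fun _ => norm_nonneg _) (fun N => ?_) (hbk k)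
    have hm := (measurableSet_torusNear k).compl
    refine (setIntegral_mono_on (hhi N).norm.integrableOn
      (integrable_const (b N * (2 * ((k : ℝ) + 1)))).integrableOn hm
      fun t ht => hbound k N t ht).trans ?_
    rw [setIntegral_const, smul_eq_mul]
    exact mul_le_of_le_one_left (mul_nonneg (hbpos N) (by positivity)) measureReal_le_one
  have hnear : torusMeasure (⋂ k, torusNear k) = 0 := by
    rw [iInter_torusNear, torusMeasure_singleton_zero]
  have hae : ∀ᵐ t ∂torusMeasure, Tendsto (fun N => h N t) atTop (𝓝 0) := by
    filter_upwards [measure_eq_zero_iff_ae_notMem.1 hnear] with t ht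
    obtain ⟨k, hk⟩ : ∃ k, t ∉ torusNear k := by simpa using ht
    exact squeeze_zero_norm (fun N => hbound k N t hk) (hbk k)
  obtain ⟨E, hE, hnoE⟩ := exists_measurableSet_not_tendsto_setIntegral (fun N => (hhi N).norm)
    (fun N t => norm_nonneg (h N t)) antitone_torusNear measurableSet_torusNear hnear hout hnot
  refine ⟨E, hE, ?_⟩
  rintro ⟨L, hL⟩
  have hd := tendsto_setIntegral_norm_sub_norm hSi hhi hfi hae hrem E
  -- A limit of `∫_E |S_N|` would give one for `∫_E |h_N|`, by subtracting the convergent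
  -- difference.
  exact hnoE ⟨_, (hL.sub hd).congr fun N => sub_sub_cancel _ _⟩
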